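/- All graphs are finite and simple. For a graph $G$, let $\operatorname{match}(G)$ denote its matching number, i.e. the number of edges in a maximum matching of $G$ (a matching being a set of pairwise vertex-disjoint edges). The graph of a real skew-symmetric matrix $A=[a_{ij}]$, with rows and columns indexed by a finite set $V$, is the graph with vertex set $V$ in which distinct $i,j$ are adjacent if and only if $a_{ij}\neq 0$. Let $S^{-}(G)$ denote the set of all real skew-symmetric matrices, with rows and columns indexed by the vertices of $G$, whose graph is $G$. **Theorem.** Let $G$ be a connected graph on $n$ vertices. 1. If $\operatorname{match}(G)=\lfloor n/2\rfloor$, then for any $n$ distinct real numbers $\lambda_1,\ldots,\lambda_n$ such that $\lambda_j=-\lambda_{n+1-j}$ for all $j=1,\ldots,n$, there is a matrix $A\in S^{-}(G)$ whose eigenvalues are $\mathrm{i}\lambda_1,\ldots,\mathrm{i}\lambda_n$ (where $\mathrm{i}^2=-1$). 2. Conversely, if there is a matrix $A\in S^{-}(G)$ with distinct eigenvalues (that is, its $n$ complex eigenvalues, counted with multiplicity, are pairwise distinct), then $\operatorname{match}(G)=\lfloor n/2\rfloor$. -/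

import Mathlib

/-- The matching number of a finite simple graph: the number of edges in a maximum matching.
The set below is nonempty (the empty matching) and bounded, so the supremum is a maximum. -/
noncomputable def matchingNumber {V : Type*} [Finite V] (G : SimpleGraph V) : ℕ :=
  sSup {k : ℕ | ∃ M : G.Subgraph, M.IsMatching ∧ M.edgeSet.ncard = k}

/-- The graph of a square matrix: distinct `i`, `j` are adjacent iff an off-diagonal entry
`A i j` or `A j i` is nonzero (for skew-symmetric `A` the two conditions coincide). -/
def graphOfMatrix {V : Type*} (A : Matrix V V ℝ) : SimpleGraph V :=
  SimpleGraph.fromRel fun i j => A i j ≠ 0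

/-- `S⁻(G)`: all real skew-symmetric matrices whose graph is `G`. -/
def skewMatrices {V : Type*} (G : SimpleGraph V) : Set (Matrix V V ℝ) :=
  {A | A.transpose = -A ∧ graphOfMatrix A = G}

/-- The multiset of complex eigenvalues of a real matrix, counted with algebraic multiplicity. -/
noncomputable def complexEigenvalues {V : Type*} [Fintype V] [DecidableEq V]
    (A : Matrix V V ℝ) : Multiset ℂ :=
  (A.map Complex.ofReal).charpoly.roots

/-!
# Matchings and skew-symmetric matrices with simple spectrum

Simple spectrum forces a large matching. Let `A` be a real skew-symmetric matrix with graph `G`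
whose eigenvalues are distinct. Its kernel is at most a line, so `A` becomes nonsingular after
deleting at most one vertex (`exists_nonsingularOn_of_kernel_le_line`). A nonsingular principal
submatrix on a vertex set `S` forces a perfect matching of `S`
(`NonsingularOn.exists_isMatching`): for `v ∈ S`, the `v`-th diagonal entry of `A A⁻¹ = 1` provides
`w` with `A v w * A⁻¹ w v ≠ 0`, the matrix stays nonsingular when `v` and `w` are deleted because
the relevant minor is `(A⁻¹ w v) ^ 2 det A` (`NonsingularOn.exists_erase_erase`), and one concludes
by induction.

A large matching allows every spectrum. List the edges `a k`, `b k` of a maximum matching and the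
prescribed values `l k` (`k < n / 2`), which are nonzero and have distinct squares. Put weight `x k`
on the `k`-th edge of the matching, and add `ε C`, where `C` is a fixed skew-symmetric matrix with
graph `G`. For skew-symmetric `A` the number `det (t + i A)` is real, and it vanishes exactly when
`i t` is an eigenvalue. So it is enough to solve the `n / 2` real equations
`det (l k + i A(ε, x)) = 0` with `ε ≠ 0`: the remaining eigenvalues follow from the symmetry
`t ↦ -t` and, for odd `n`, from the singularity of `A`. At `ε = 0`, `x = l` the equations hold, and
their Jacobian in `x` is diagonal with nonzero diagonal, because up to sign the `k`-th equation is
`∏ j, (l k ^ 2 - x j ^ 2) = 0`, with an extra factor `l k` for an unmatched vertex. The sign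
plays no role: the square of the determinant is
`det (t ^ 2 + A ^ 2)`, the determinant of a diagonal matrix
(`hermitianDet_weightedMatching_sq`). By the inverse function theorem there are solutions with
`ε ≠ 0` arbitrarily close to `(0, l)` (`exists_zero_of_diagonal_jacobian`), and near `(0, l)` the
matrix has nonzero entries on the matching, so its graph is `G`.
-/

open Matrix

/-! ### Nonsingular principal submatrices of skew-symmetric matrices -/

/-- `A` is *nonsingular on `S`* if the principal submatrix of `A` with rows and columns in `S` has
trivial kernel. Vectors on `S` are encoded as vectors on `V` vanishing off `S`. -/
def NonsingularOn {V : Type*} [Fintype V] (A : Matrix V V ℝ) (S : Finset V) : Prop :=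
  ∀ y : V → ℝ, (∀ i ∉ S, y i = 0) → (∀ i ∈ S, (A *ᵥ y) i = 0) → y = 0

theorem dotProduct_mulVec_skew {V R : Type*} [Fintype V] [CommRing R] {A : Matrix V V R}
    (hA : A.transpose = -A) (x y : V → R) : x ⬝ᵥ A *ᵥ y = -(y ⬝ᵥ A *ᵥ x) := by
  rw [dotProduct_mulVec, ← mulVec_transpose, hA, neg_mulVec, neg_dotProduct, dotProduct_comm]

theorem NonsingularOn.exists_mulVec_eq_single {V : Type*} [Fintype V] [DecidableEq V]
    {A : Matrix V V ℝ} {S : Finset V} (h : NonsingularOn A S) {v : V} (hv : v ∈ S) :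
    ∃ u : V → ℝ, (∀ i ∉ S, u i = 0) ∧ ∀ i ∈ S, (A *ᵥ u) i = (Pi.single v 1 : V → ℝ) i := by
  -- Extend the principal submatrix to an endomorphism of `V → ℝ` by the identity off `S`.
  let L : (V → ℝ) →ₗ[ℝ] (V → ℝ) :=
    { toFun := fun y i => if i ∈ S then (A *ᵥ fun j => if j ∈ S then y j else 0) i else y i
      map_add' := by
        intro x y
        ext i
        by_cases hi : i ∈ S
        · simp only [hi, if_true, Pi.add_apply, mulVec, dotProduct, ← Finset.sum_add_distrib]
          refine Finset.sum_congr rfl fun j _ => ?_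
          split_ifs <;> ring
        · simp [hi]
      map_smul' := by
        intro c y
        ext i
        by_cases hi : i ∈ S
        · simp only [hi, if_true, Pi.smul_apply, mulVec, dotProduct, smul_eq_mul, Finset.mul_sum,
            RingHom.id_apply]
          refine Finset.sum_congr rfl fun j _ => ?_
          split_ifs <;> ring
        · simp [hi] }
  have hLi (y : V → ℝ) (i : V) : L y i =
    if i ∈ S then (A *ᵥ fun j => if j ∈ S then y j else 0) i else y i := rfl
  have hext (y : V → ℝ) (hy : ∀ i ∉ S, y i = 0) : (fun j => if j ∈ S then y j else 0) = y := by
    ext j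
    by_cases hj : j ∈ S <;> simp [hj, hy]
  have hinj : Function.Injective L := by
    rw [injective_iff_map_eq_zero]
    intro y hy
    have hoff : ∀ i ∉ S, y i = 0 := fun i hi => by simpa [hLi, hi] using congrFun hy i
    refine h y hoff fun i hi => ?_
    simpa [hLi, hi, hext y hoff] using congrFun hy i
  obtain ⟨u, hu⟩ := LinearMap.injective_iff_surjective.mp hinj (Pi.single v 1)
  have hoff : ∀ i ∉ S, u i = 0 := fun i hi => by
    have hiv : i ≠ v := fun e => hi (e ▸ hv)
    simpa [hLi, hi, hiv] using congrFun hu i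
  refine ⟨u, hoff, fun i hi => ?_⟩
  simpa [hLi, hi, hext u hoff] using congrFun hu i

/-- If `y` vanishes off `S`, pairing `y` with a vector only sees the coordinates in `S`. -/
theorem dotProduct_eq_of_eqOn {V : Type*} [Fintype V] {S : Finset V} {y z z' : V → ℝ}
    (hy : ∀ i ∉ S, y i = 0) (hz : ∀ i ∈ S, z i = z' i) : y ⬝ᵥ z = y ⬝ᵥ z' := by
  refine Finset.sum_congr rfl fun i _ => ?_
  by_cases hi : i ∈ S
  · rw [hz i hi]
  · simp [hy i hi]

/-- The pivoting step: one edge `vw` can be removed from a nonsingular principal submatrix of a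
skew-symmetric matrix so that the remaining principal submatrix is again nonsingular. In terms of
the inverse `B` of the submatrix, `w` is chosen with `A v w * B w v ≠ 0`, and by Jacobi's identity
the remaining minor is the original one times `(B w v) ^ 2`. -/
theorem NonsingularOn.exists_erase_erase {V : Type*} [Fintype V] [DecidableEq V]
    {A : Matrix V V ℝ} (hA : A.transpose = -A) {S : Finset V} (h : NonsingularOn A S)
    {v : V} (hv : v ∈ S) :
    ∃ w ∈ S, A v w ≠ 0 ∧ NonsingularOn A ((S.erase v).erase w) := by
  obtain ⟨u, hu0, hu⟩ := h.exists_mulVec_eq_single hv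
  have hsum : ∑ w, A v w * u w ≠ 0 := by
    have := hu v hv
    simp only [mulVec, dotProduct, Pi.single_eq_same] at this
    simp [this]
  obtain ⟨w, -, hw⟩ := Finset.exists_ne_zero_of_sum_ne_zero hsum
  have hAw : A v w ≠ 0 := left_ne_zero_of_mul hw
  have huw : u w ≠ 0 := right_ne_zero_of_mul hw
  have hwS : w ∈ S := by
    by_contra hwS
    exact huw (hu0 w hwS)
  obtain ⟨u', hu0', hu'⟩ := h.exists_mulVec_eq_single hwS
  have hpair (x : V → ℝ) (hx : ∀ i ∉ S, x i = 0) : x ⬝ᵥ A *ᵥ u = x v := by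
    rw [dotProduct_eq_of_eqOn hx hu, dotProduct_single_one]
  have hpair' (x : V → ℝ) (hx : ∀ i ∉ S, x i = 0) : x ⬝ᵥ A *ᵥ u' = x w := by
    rw [dotProduct_eq_of_eqOn hx hu', dotProduct_single_one]
  have huv : u v = 0 := by
    have h1 := hpair u hu0
    have h2 := dotProduct_mulVec_skew hA u u
    linarith
  have huv' : u' v = -u w := by
    rw [← hpair u' hu0', ← hpair' u hu0, dotProduct_mulVec_skew hA]
  have huw' : u' w = 0 := by
    have h1 := hpair' u' hu0'
    have h2 := dotProduct_mulVec_skew hA u' u'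
    linarith
  have hvw : v ≠ w := by
    rintro rfl
    exact huw huv
  refine ⟨w, hwS, hAw, fun y hy0 hy => ?_⟩
  have hyS : ∀ i ∉ S, y i = 0 := fun i hi => hy0 i fun hi' =>
    hi (Finset.mem_of_mem_erase (Finset.mem_of_mem_erase hi'))
  have hyv : y v = 0 := hy0 v (by simp)
  have hyw : y w = 0 := hy0 w (by simp)
  -- On `S`, the vector `A y` is a combination of the unit vectors at `v` and `w`.
  have hAy : ∀ i ∈ S, (A *ᵥ y) i =
      ((A *ᵥ y) v • (Pi.single v 1 : V → ℝ) + (A *ᵥ y) w • (Pi.single w 1 : V → ℝ)) i := by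
    intro i hi
    by_cases hiv : i = v
    · subst hiv; simp [hvw]
    by_cases hiw : i = w
    · subst hiw; simp [hiv]
    simp [hiv, hiw, hy i (by simp [hi, hiv, hiw])]
  have key (x : V → ℝ) (hx : ∀ i ∉ S, x i = 0) :
      x ⬝ᵥ A *ᵥ y = (A *ᵥ y) v * x v + (A *ᵥ y) w * x w := by
    rw [dotProduct_eq_of_eqOn hx hAy]
    simp
  have h1 := key u hu0
  rw [dotProduct_mulVec_skew hA, hpair y hyS, hyv, huv] at h1
  have h2 := key u' hu0'
  rw [dotProduct_mulVec_skew hA, hpair' y hyS, hyw, huv', huw'] at h2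
  have hb : (A *ᵥ y) w = 0 := by
    have : (A *ᵥ y) w * u w = 0 := by linarith
    exact (mul_eq_zero.mp this).resolve_right huw
  have ha : (A *ᵥ y) v = 0 := by
    have : (A *ᵥ y) v * u w = 0 := by linarith
    exact (mul_eq_zero.mp this).resolve_right huw
  refine h y hyS fun i hi => ?_
  rw [hAy i hi, ha, hb]
  simp

theorem graphOfMatrix_adj_of_ne_zero {V : Type*} {A : Matrix V V ℝ} (hA : A.transpose = -A)
    {v w : V} (h : A v w ≠ 0) : (graphOfMatrix A).Adj v w := by
  rw [graphOfMatrix, SimpleGraph.fromRel_adj]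
  refine ⟨?_, Or.inl h⟩
  rintro rfl
  have := congrFun (congrFun hA v) v
  rw [transpose_apply, Matrix.neg_apply] at this
  exact h (by linarith)

/-- A skew-symmetric matrix with a nonsingular principal submatrix on `S` has a matching covering
exactly `S` in its graph. -/
theorem NonsingularOn.exists_isMatching {V : Type*} [Fintype V] [DecidableEq V]
    {A : Matrix V V ℝ} (hA : A.transpose = -A) (S : Finset V) (h : NonsingularOn A S) :
    ∃ M : (graphOfMatrix A).Subgraph, M.IsMatching ∧ M.verts = S ∧
      2 * M.edgeSet.ncard = S.card := by
  induction hk : S.card using Nat.strong_induction_on generalizing S with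
  | _ k ih =>
  subst hk
  rcases S.eq_empty_or_nonempty with rfl | ⟨v, hv⟩
  · exact ⟨⊥, by simp [SimpleGraph.Subgraph.IsMatching], by simp, by simp⟩
  obtain ⟨w, hw, hvw, hS⟩ := h.exists_erase_erase hA hv
  have hadj := graphOfMatrix_adj_of_ne_zero hA hvw
  have hwS : w ∈ S.erase v := Finset.mem_erase.mpr ⟨hadj.ne', hw⟩
  have hc1 := Finset.card_erase_add_one hwS
  have hc2 := Finset.card_erase_add_one hv
  obtain ⟨M, hM, hMS, hMc⟩ := ih _ (by omega) _ hS rfl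
  have hdisj : Disjoint M.verts ((graphOfMatrix A).subgraphOfAdj hadj).verts := by
    rw [hMS]
    simp
  refine ⟨M ⊔ (graphOfMatrix A).subgraphOfAdj hadj, ?_, ?_, ?_⟩
  · refine hM.sup (SimpleGraph.Subgraph.IsMatching.subgraphOfAdj hadj) ?_
    rw [hM.support_eq_verts]
    exact hdisj.mono_right (SimpleGraph.Subgraph.support_subset_verts _)
  · rw [SimpleGraph.Subgraph.verts_sup, hMS]
    ext i
    simp only [SimpleGraph.subgraphOfAdj_verts, Set.mem_union, Finset.mem_coe, Finset.mem_erase,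
      Set.mem_insert_iff, Set.mem_singleton_iff]
    by_cases h1 : i = v
    · simp [h1, hv]
    by_cases h2 : i = w
    · simp [h2, hw]
    simp [h1, h2]
  · have hnot : s(v, w) ∉ M.edgeSet := by
      intro hmem
      have := M.edge_vert (SimpleGraph.Subgraph.mem_edgeSet.mp hmem)
      rw [hMS] at this
      simp at this
    rw [SimpleGraph.Subgraph.edgeSet_sup, SimpleGraph.edgeSet_subgraphOfAdj, Set.union_singleton,
      Set.ncard_insert_of_notMem hnot (Set.toFinite _)]
    omega

/-! ### Matching numbers -/

/-- The edges of a matching, listed with their endpoints. -/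
theorem SimpleGraph.Subgraph.IsMatching.exists_endpoints {V : Type*} [Finite V]
    {G : SimpleGraph V} {M : G.Subgraph} (hM : M.IsMatching) {m : ℕ} (hm : M.edgeSet.ncard = m) :
    ∃ a b : Fin m → V, (∀ k, G.Adj (a k) (b k)) ∧ Function.Injective (Sum.elim a b) := by
  have e : Fin m ≃ M.edgeSet := (Finite.equivFinOfCardEq hm).symm
  have hex : ∀ k, ∃ p : V × V, M.Adj p.1 p.2 ∧ s(p.1, p.2) = (e k : Sym2 V) := by
    intro k
    obtain ⟨z, hz⟩ := e k
    induction z with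
    | _ x y => exact ⟨(x, y), hz, rfl⟩
  choose p hp hpe using hex
  have hinj : ∀ j k, s((p j).1, (p j).2) = s((p k).1, (p k).2) → j = k := by
    intro j k h
    rw [hpe, hpe] at h
    exact e.injective (Subtype.ext h)
  have hswap : ∀ j k, (p j).1 ≠ (p k).2 := by
    intro j k h
    have h1 : (p j).2 = (p k).1 := hM.eq_of_adj_left (h ▸ hp j) (hp k).symm
    have : j = k := hinj j k (by rw [h, h1, Sym2.eq_swap])
    subst this
    exact (hp j).ne h
  refine ⟨fun k => (p k).1, fun k => (p k).2, fun k => (hp k).adj_sub, ?_⟩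
  refine Function.Injective.sumElim (fun j k h => ?_) (fun j k h => ?_) hswap
  · exact hinj j k (by
    have h' : (p j).1 = (p k).1 := h
    rw [h', hM.eq_of_adj_left (v := (p j).2) (w := (p k).2) (h' ▸ hp j) (hp k)])
  · exact hinj j k (by
    have h' : (p j).2 = (p k).2 := h
    rw [h', hM.eq_of_adj_right (u := (p j).1) (v := (p k).1) (h' ▸ hp j) (hp k)])

theorem SimpleGraph.Subgraph.IsMatching.two_mul_ncard_edgeSet_le {V : Type*} [Fintype V]
    {G : SimpleGraph V} {M : G.Subgraph} (hM : M.IsMatching) :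
    2 * M.edgeSet.ncard ≤ Fintype.card V := by
  obtain ⟨a, b, -, h⟩ := hM.exists_endpoints rfl
  have := Fintype.card_le_of_injective _ h
  simp only [Fintype.card_sum, Fintype.card_fin] at this
  omega

theorem bddAbove_matching_sizes {V : Type*} [Fintype V] (G : SimpleGraph V) :
    BddAbove {k : ℕ | ∃ M : G.Subgraph, M.IsMatching ∧ M.edgeSet.ncard = k} := by
  refine ⟨Fintype.card V, ?_⟩
  rintro k ⟨M, hM, rfl⟩
  have := hM.two_mul_ncard_edgeSet_le
  omega

theorem exists_isMatching_ncard_eq_matchingNumber {V : Type*} [Fintype V] (G : SimpleGraph V) :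
    ∃ M : G.Subgraph, M.IsMatching ∧ M.edgeSet.ncard = matchingNumber G :=
  Nat.sSup_mem (s := {k : ℕ | ∃ M : G.Subgraph, M.IsMatching ∧ M.edgeSet.ncard = k})
    ⟨0, ⊥, by simp [SimpleGraph.Subgraph.IsMatching], by simp⟩ (bddAbove_matching_sizes G)

theorem matchingNumber_eq_half {V : Type*} [Fintype V] {G : SimpleGraph V} {M : G.Subgraph}
    (hM : M.IsMatching) (h : Fintype.card V ≤ 2 * M.edgeSet.ncard + 1) :
    matchingNumber G = Fintype.card V / 2 := by
  have h1 : M.edgeSet.ncard ≤ matchingNumber G :=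
    le_csSup (bddAbove_matching_sizes G) ⟨M, hM, rfl⟩
  obtain ⟨N, hN, hNc⟩ := exists_isMatching_ncard_eq_matchingNumber G
  have := hN.two_mul_ncard_edgeSet_le
  omega

/-! ### Simple spectrum forces a large matching -/

/-- A skew-symmetric matrix whose kernel is at most a line becomes nonsingular after deleting at
most one vertex: any vertex on which a kernel vector does not vanish will do. -/
theorem exists_nonsingularOn_of_kernel_le_line {V : Type*} [Fintype V] [DecidableEq V]
    {A : Matrix V V ℝ} (hA : A.transpose = -A)
    (hker : ∀ x y : V → ℝ, A *ᵥ x = 0 → A *ᵥ y = 0 → x ≠ 0 → ∃ t : ℝ, y = t • x) :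
    ∃ S : Finset V, NonsingularOn A S ∧ Fintype.card V ≤ S.card + 1 := by
  by_cases h : ∃ x : V → ℝ, A *ᵥ x = 0 ∧ x ≠ 0
  · obtain ⟨x, hx, hx0⟩ := h
    obtain ⟨v, hv⟩ := Function.ne_iff.mp hx0
    refine ⟨Finset.univ.erase v, fun y hy0 hy => ?_, ?_⟩
    · have hyv : y v = 0 := hy0 v (by simp)
      have hAy : A *ᵥ y = Pi.single v ((A *ᵥ y) v) := by
        ext i
        by_cases hi : i = v
        · subst hi; simp
        · simp [hi, hy i (by simp [hi])]
      have h0 := dotProduct_mulVec_skew hA x y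
      rw [hx, dotProduct_zero, neg_zero, hAy, dotProduct_single] at h0
      have h1 : (A *ᵥ y) v = 0 := (mul_eq_zero.mp h0).resolve_left hv
      rw [h1, Pi.single_zero] at hAy
      obtain ⟨t, rfl⟩ := hker x y hx hAy hx0
      have : t = 0 := (mul_eq_zero.mp hyv).resolve_right hv
      simp [this]
    · rw [Finset.card_erase_of_mem (Finset.mem_univ v), Finset.card_univ]
      omega
  · push Not at h
    exact ⟨Finset.univ, fun y _ hy => h y (funext fun i => hy i (Finset.mem_univ i)),
      by rw [Finset.card_univ]; omega⟩

/-- A matrix with simple spectrum has kernel at most a line. -/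
theorem exists_eq_smul_of_nodup_complexEigenvalues {V : Type*} [Fintype V] [DecidableEq V]
    {A : Matrix V V ℝ} (h : (complexEigenvalues A).Nodup) {x y : V → ℝ} (hx : A *ᵥ x = 0)
    (hy : A *ᵥ y = 0) (hx0 : x ≠ 0) : ∃ t : ℝ, y = t • x := by
  have hroot : A.charpoly.rootMultiplicity 0 ≤ 1 := by
    have h1 : A.charpoly.roots.Nodup := by
      refine Multiset.Nodup.of_map Complex.ofRealHom (Multiset.nodup_of_le ?_ h)
      change _ ≤ (A.map Complex.ofRealHom).charpoly.roots
      rw [Matrix.charpoly_map]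
      exact Polynomial.map_roots_le
        ((Polynomial.Monic.map _ (Matrix.charpoly_monic A)).ne_zero)
    rw [← Polynomial.count_roots]
    exact Multiset.nodup_iff_count_le_one.mp h1 0
  have hfin : Module.finrank ℝ (Module.End.eigenspace (toLin' A) 0) ≤ 1 := by
    refine (LinearMap.finrank_eigenspace_le _ _).trans ?_
    rwa [Matrix.charpoly_toLin']
  have hmem (z : V → ℝ) (hz : A *ᵥ z = 0) : z ∈ Module.End.eigenspace (toLin' A) 0 := by
    rw [Module.End.mem_eigenspace_iff, toLin'_apply, hz, zero_smul]
  obtain ⟨z, hz⟩ := finrank_le_one_iff.mp hfin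
  obtain ⟨a, ha⟩ := hz ⟨x, hmem x hx⟩
  obtain ⟨b, hb⟩ := hz ⟨y, hmem y hy⟩
  have ha' : a • (z : V → ℝ) = x := congrArg Subtype.val ha
  have hb' : b • (z : V → ℝ) = y := congrArg Subtype.val hb
  have ha0 : a ≠ 0 := by
    rintro rfl
    exact hx0 (by rw [← ha', zero_smul])
  exact ⟨b / a, by rw [← ha', ← hb', smul_smul, div_mul_cancel₀ _ ha0]⟩

theorem matchingNumber_eq_half_of_nodup {V : Type*} [Fintype V] [DecidableEq V]
    {G : SimpleGraph V} {A : Matrix V V ℝ} (hA : A ∈ skewMatrices G)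
    (h : (complexEigenvalues A).Nodup) : matchingNumber G = Fintype.card V / 2 := by
  obtain ⟨hskew, rfl⟩ := hA
  obtain ⟨S, hS, hcard⟩ := exists_nonsingularOn_of_kernel_le_line hskew
    fun x y hx hy hx0 => exists_eq_smul_of_nodup_complexEigenvalues h hx hy hx0
  obtain ⟨M, hM, -, hMc⟩ := hS.exists_isMatching hskew
  exact matchingNumber_eq_half hM (by omega)

/-! ### The characteristic polynomial on the imaginary axis -/

/-- The real function `t ↦ det (t + i A)`. For real skew-symmetric `A` the matrix `t + i A` is
Hermitian, so this determinant is real and taking the real part loses nothing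
(`ofReal_hermitianDet`). -/
noncomputable def hermitianDet {V : Type*} [Fintype V] [DecidableEq V] (A : Matrix V V ℝ)
    (t : ℝ) : ℝ :=
  ((t : ℂ) • (1 : Matrix V V ℂ) + Complex.I • A.map Complex.ofReal).det.re

theorem transpose_map_ofReal {V : Type*} {A : Matrix V V ℝ} (hA : A.transpose = -A) :
    (A.map Complex.ofReal).transpose = -A.map Complex.ofReal := by
  rw [← transpose_map, hA]
  ext i j
  simp

section HermitianDet

variable {V : Type*} [Fintype V] [DecidableEq V] {A : Matrix V V ℝ}

theorem ofReal_hermitianDet (hA : A.transpose = -A) (t : ℝ) :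
    (hermitianDet A t : ℂ) =
      ((t : ℂ) • (1 : Matrix V V ℂ) + Complex.I • A.map Complex.ofReal).det := by
  rw [hermitianDet, ← Complex.conj_eq_iff_re, starRingEnd_apply,
    ← det_conjTranspose]
  congr 1
  have : (A.map Complex.ofReal)ᴴ = -A.map Complex.ofReal := by
    rw [← transpose_map_ofReal hA]
    ext i j
    simp
  rw [conjTranspose_add, conjTranspose_smul, conjTranspose_smul, this, conjTranspose_one]
  simp

theorem det_sub_I_smul (hA : A.transpose = -A) (t : ℝ) :
    ((t : ℂ) • (1 : Matrix V V ℂ) - Complex.I • A.map Complex.ofReal).det =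
      ((t : ℂ) • (1 : Matrix V V ℂ) + Complex.I • A.map Complex.ofReal).det := by
  rw [← det_transpose, transpose_sub, transpose_smul, transpose_smul, transpose_map_ofReal hA,
    transpose_one, smul_neg, sub_neg_eq_add]

theorem hermitianDet_neg (hA : A.transpose = -A) {t : ℝ} (h : hermitianDet A t = 0) :
    hermitianDet A (-t) = 0 := by
  rw [← Complex.ofReal_eq_zero, ofReal_hermitianDet hA] at h ⊢
  have : (((-t : ℝ) : ℂ) • (1 : Matrix V V ℂ) + Complex.I • A.map Complex.ofReal) =
      -((t : ℂ) • (1 : Matrix V V ℂ) - Complex.I • A.map Complex.ofReal) := by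
    rw [Complex.ofReal_neg]
    module
  rw [this, det_neg, det_sub_I_smul hA, h, mul_zero]

/-- A skew-symmetric matrix of odd order is singular. -/
theorem hermitianDet_zero_of_odd (hA : A.transpose = -A) (hV : Odd (Fintype.card V)) :
    hermitianDet A 0 = 0 := by
  rw [← Complex.ofReal_eq_zero, ofReal_hermitianDet hA]
  have h := det_sub_I_smul hA 0
  rw [Complex.ofReal_zero, zero_smul, zero_sub, zero_add, det_neg, hV.neg_one_pow] at h
  rw [Complex.ofReal_zero, zero_smul, zero_add]
  linear_combination (-1 / 2 : ℂ) * h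

theorem isRoot_charpoly_of_hermitianDet (hA : A.transpose = -A) {t : ℝ}
    (h : hermitianDet A t = 0) :
    (A.map Complex.ofReal).charpoly.IsRoot (Complex.I * (t : ℂ)) := by
  rw [← Complex.ofReal_eq_zero, ofReal_hermitianDet hA] at h
  rw [Polynomial.IsRoot, eval_charpoly]
  have : scalar V (Complex.I * (t : ℂ)) - A.map Complex.ofReal =
      Complex.I • ((t : ℂ) • (1 : Matrix V V ℂ) + Complex.I • A.map Complex.ofReal) := by
    rw [smul_add, smul_smul, smul_smul, Complex.I_mul_I, scalar_apply,
      ← smul_one_eq_diagonal]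
    module
  rw [this, det_smul, h, mul_zero]

/-- As `det (t - i A) = det (t + i A)`, the square of this determinant is `det (t² + A²)`. -/
theorem hermitianDet_sq (hA : A.transpose = -A) (t : ℝ) :
    hermitianDet A t ^ 2 = (t ^ 2 • (1 : Matrix V V ℝ) + A * A).det := by
  apply Complex.ofReal_injective
  rw [Complex.ofReal_pow, ofReal_hermitianDet hA, pow_two]
  nth_rewrite 2 [← det_sub_I_smul hA]
  rw [← det_mul, ← Complex.ofRealHom_eq_coe, ← Complex.ofRealHom_eq_coe, RingHom.map_det]
  congr 1
  rw [RingHom.mapMatrix_apply, Matrix.map_add _ (map_add _), Matrix.map_mul]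
  have : (t ^ 2 • (1 : Matrix V V ℝ)).map Complex.ofRealHom = ((t : ℂ) ^ 2) • 1 := by
    ext i j
    by_cases hij : i = j <;> simp [hij]
  rw [this]
  simp only [Complex.ofRealHom_eq_coe, add_mul, mul_sub, smul_mul_smul_comm, mul_smul,
    Complex.I_mul_I]
  simp only [one_mul, mul_one]
  module

/-- If `det (t + i A)` vanishes at all the prescribed values, then these are the eigenvalues. -/
theorem complexEigenvalues_eq_of_hermitianDet {n : ℕ} (hn : Fintype.card V = n)
    (hA : A.transpose = -A) {l : Fin n → ℝ} (hl : Function.Injective l)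
    (h : ∀ j, hermitianDet A (l j) = 0) :
    complexEigenvalues A =
      (Finset.univ : Finset (Fin n)).val.map fun j => Complex.I * (l j : ℂ) := by
  symm
  refine Multiset.eq_of_le_of_card_le ?_ ?_
  · refine (Multiset.le_iff_subset ?_).mpr ?_
    · refine Finset.univ.nodup.map fun i j hij => hl ?_
      exact Complex.ofReal_injective (mul_left_cancel₀ Complex.I_ne_zero hij)
    · intro z hz
      obtain ⟨j, -, rfl⟩ := Multiset.mem_map.mp hz
      exact (Polynomial.mem_roots (charpoly_monic _).ne_zero).mpr
        (isRoot_charpoly_of_hermitianDet hA (h j))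
  · refine (Polynomial.card_roots' _).trans ?_
    rw [charpoly_natDegree_eq_dim, hn]
    simp

end HermitianDet

/-! ### Skew-symmetric matrices concentrated on a matching -/

/-- The matrix with `ε C` in the background and weights `x k` added (skew-symmetrically) at the
pairs `a k`, `b k`. Here `p = (ε, x)`. -/
def weightedMatching {V : Type*} [DecidableEq V] {m : ℕ} (C : Matrix V V ℝ) (a b : Fin m → V)
    (p : ℝ × (Fin m → ℝ)) : Matrix V V ℝ :=
  p.1 • C + ∑ k, p.2 k • (single (a k) (b k) 1 - single (b k) (a k) 1)

/-- Every graph is the graph of some skew-symmetric matrix. -/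
theorem exists_skew_of_adj {V : Type*} [Finite V] (G : SimpleGraph V) :
    ∃ C : Matrix V V ℝ, C.transpose = -C ∧ ∀ i j, C i j ≠ 0 ↔ G.Adj i j := by
  classical
  obtain ⟨n, ⟨e⟩⟩ := Finite.exists_equiv_fin V
  refine ⟨of fun i j => if G.Adj i j then ((e i : ℕ) : ℝ) - ((e j : ℕ) : ℝ) else 0, ?_, ?_⟩
  · ext i j
    by_cases h : G.Adj i j <;> simp [h, G.adj_comm j i]
  · intro i j
    by_cases h : G.Adj i j
    · have : (e i : ℕ) ≠ e j := fun h' => h.ne (e.injective (Fin.ext h'))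
      simpa [h, sub_eq_zero] using this
    · simp [h]

section WeightedMatching

variable {V : Type*} [DecidableEq V] {m : ℕ} {C : Matrix V V ℝ} {a b : Fin m → V}

theorem transpose_weightedMatching (hC : C.transpose = -C) (p : ℝ × (Fin m → ℝ)) :
    (weightedMatching C a b p).transpose = -weightedMatching C a b p := by
  rw [weightedMatching, transpose_add, transpose_smul, hC, transpose_sum, neg_add, smul_neg,
    ← Finset.sum_neg_distrib]
  congr 1
  refine Finset.sum_congr rfl fun k _ => ?_
  rw [transpose_smul, transpose_sub, transpose_single, transpose_single, ← smul_neg, neg_sub]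

theorem weightedMatching_apply (p : ℝ × (Fin m → ℝ)) (i j : V) :
    weightedMatching C a b p i j = p.1 * C i j + ∑ k, p.2 k *
      ((if a k = i ∧ b k = j then 1 else 0) - (if b k = i ∧ a k = j then 1 else 0)) := by
  simp [weightedMatching, Matrix.sum_apply, single_apply]

theorem weightedMatching_apply_endpoints (hab : Function.Injective (Sum.elim a b))
    (p : ℝ × (Fin m → ℝ)) (k : Fin m) :
    weightedMatching C a b p (a k) (b k) = p.1 * C (a k) (b k) + p.2 k := by
  have ha : ∀ i j, a i = a j ↔ i = j := fun i j => (hab.comp Sum.inl_injective).eq_iff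
  have hne : ∀ i j, b i ≠ a j := fun i j h => Sum.inr_ne_inl (hab (a₁ := .inr i) (a₂ := .inl j) h)
  rw [weightedMatching_apply, Finset.sum_eq_single k]
  · simp [hne]
  · intro j _ hj
    simp [ha, hne, hj]
  · simp

theorem weightedMatching_mem_skewMatrices {G : SimpleGraph V} (hC : C.transpose = -C)
    (hCG : ∀ i j, C i j ≠ 0 ↔ G.Adj i j) (hG : ∀ k, G.Adj (a k) (b k))
    (hab : Function.Injective (Sum.elim a b)) {p : ℝ × (Fin m → ℝ)} (hp : p.1 ≠ 0)
    (hpk : ∀ k, p.1 * C (a k) (b k) + p.2 k ≠ 0) :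
    weightedMatching C a b p ∈ skewMatrices G := by
  have hT := transpose_weightedMatching (a := a) (b := b) hC p
  have hT' (i j : V) : weightedMatching C a b p j i = -weightedMatching C a b p i j :=
    congrFun (congrFun hT i) j
  have key (i j : V) : weightedMatching C a b p i j ≠ 0 ↔ G.Adj i j := by
    by_cases h1 : ∃ k, a k = i ∧ b k = j
    · obtain ⟨k, rfl, rfl⟩ := h1
      rw [weightedMatching_apply_endpoints hab]
      exact iff_of_true (hpk k) (hG k)
    by_cases h2 : ∃ k, b k = i ∧ a k = j
    · obtain ⟨k, rfl, rfl⟩ := h2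
      rw [hT', neg_ne_zero, weightedMatching_apply_endpoints hab]
      exact iff_of_true (hpk k) (hG k).symm
    push Not at h1 h2
    rw [weightedMatching_apply, Finset.sum_eq_zero, add_zero, ← hCG, mul_ne_zero_iff]
    · exact and_iff_right hp
    · intro k _
      rw [if_neg (by rintro ⟨h, h'⟩; exact h1 k h h'), if_neg (by rintro ⟨h, h'⟩; exact h2 k h h'),
        sub_zero, mul_zero]
  refine ⟨hT, ?_⟩
  ext i j
  rw [graphOfMatrix, SimpleGraph.fromRel_adj, key, key, G.adj_comm j i, or_self]
  exact and_iff_right_of_imp fun h => h.ne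

theorem sum_weights_at_fst (hab : Function.Injective (Sum.elim a b)) (x : Fin m → ℝ)
    (k : Fin m) :
    ∑ j, x j ^ 2 * ((if a j = a k then 1 else 0) + (if b j = a k then 1 else 0)) = x k ^ 2 := by
  have ha : ∀ i j, a i = a j ↔ i = j := fun i j => (hab.comp Sum.inl_injective).eq_iff
  have hne : ∀ i j, b i ≠ a j := fun i j h => Sum.inr_ne_inl (hab (a₁ := .inr i) (a₂ := .inl j) h)
  simp [ha, hne]

theorem sum_weights_at_snd (hab : Function.Injective (Sum.elim a b)) (x : Fin m → ℝ)
    (k : Fin m) :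
    ∑ j, x j ^ 2 * ((if a j = b k then 1 else 0) + (if b j = b k then 1 else 0)) = x k ^ 2 := by
  have hb : ∀ i j, b i = b j ↔ i = j := fun i j => (hab.comp Sum.inr_injective).eq_iff
  have hne : ∀ i j, a i ≠ b j := fun i j h => Sum.inl_ne_inr (hab (a₁ := .inl i) (a₂ := .inr j) h)
  simp [hb, hne]

variable [Fintype V]

/-- Without background the square of the matrix is diagonal, since it is a direct sum of blocks
`!![0, x; -x, 0]` and zeros. The sum over `k` is the squared weight of the matching edge at `v`, or
zero if `v` is unmatched. -/
theorem sq_smul_one_add_weightedMatching_sq (hab : Function.Injective (Sum.elim a b))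
    (x : Fin m → ℝ) (t : ℝ) :
    t ^ 2 • (1 : Matrix V V ℝ) + weightedMatching C a b (0, x) * weightedMatching C a b (0, x) =
      diagonal fun v => t ^ 2 - ∑ k, x k ^ 2 * ((if a k = v then 1 else 0) +
        (if b k = v then 1 else 0)) := by
  have ha : ∀ i j, a i = a j ↔ i = j := fun i j => (hab.comp Sum.inl_injective).eq_iff
  have hb : ∀ i j, b i = b j ↔ i = j := fun i j => (hab.comp Sum.inr_injective).eq_iff
  have hne : ∀ i j, b i ≠ a j := fun i j h => Sum.inr_ne_inl (hab (a₁ := .inr i) (a₂ := .inl j) h)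
  have hprod : weightedMatching C a b (0, x) * weightedMatching C a b (0, x) =
      -∑ k, x k ^ 2 • (single (a k) (a k) 1 + single (b k) (b k) 1) := by
    simp only [weightedMatching, zero_smul, zero_add]
    rw [Finset.sum_mul_sum, ← Finset.sum_neg_distrib]
    refine Finset.sum_congr rfl fun k _ => ?_
    rw [Finset.sum_eq_single k]
    · rw [smul_mul_smul_comm, ← pow_two, ← smul_neg, sub_mul, mul_sub, mul_sub,
        single_mul_single_of_ne _ _ _ _ (hne k k), single_mul_single_same,
        single_mul_single_same, single_mul_single_of_ne _ _ _ _ (hne k k).symm]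
      congr 1
      simp only [mul_one]
      abel
    · intro j _ hj
      rw [smul_mul_smul_comm, sub_mul, mul_sub, mul_sub,
        single_mul_single_of_ne _ _ _ _ (hne k j),
        single_mul_single_of_ne _ _ _ _ (fun h => hj ((hb _ _).mp h).symm),
        single_mul_single_of_ne _ _ _ _ (fun h => hj ((ha _ _).mp h).symm),
        single_mul_single_of_ne _ _ _ _ (hne j k).symm]
      simp
    · simp
  rw [hprod]
  ext i j
  rw [Matrix.add_apply, Matrix.smul_apply, Matrix.neg_apply, Matrix.sum_apply]
  by_cases hij : i = j
  · subst hij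
    simp [single_apply, sub_eq_add_neg]
  · have h1 : ∀ v : V, ¬ (v = i ∧ v = j) := fun v h => hij (h.1.symm.trans h.2)
    simp [hij, h1]

theorem hermitianDet_weightedMatching_sq (hC : C.transpose = -C)
    (hab : Function.Injective (Sum.elim a b)) (x : Fin m → ℝ) (t : ℝ) :
    hermitianDet (weightedMatching C a b (0, x)) t ^ 2 =
      ∏ v, (t ^ 2 - ∑ k, x k ^ 2 * ((if a k = v then 1 else 0) + (if b k = v then 1 else 0))) := by
  rw [hermitianDet_sq (transpose_weightedMatching hC _), sq_smul_one_add_weightedMatching_sq hab,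
    det_diagonal]

theorem hermitianDet_weightedMatching_eq_zero (hC : C.transpose = -C)
    (hab : Function.Injective (Sum.elim a b)) (x : Fin m → ℝ) (k : Fin m) :
    hermitianDet (weightedMatching C a b (0, x)) (x k) = 0 := by
  refine pow_eq_zero_iff (two_ne_zero) |>.mp ?_
  rw [hermitianDet_weightedMatching_sq hC hab]
  refine Finset.prod_eq_zero (Finset.mem_univ (a k)) ?_
  rw [sum_weights_at_fst hab, sub_self]

/-- Moving one weight away from `l k` by `s` makes `det (l k + i A)` vanish to first order in `s`
exactly. -/
theorem exists_hermitianDet_weightedMatching_sq_eq (hC : C.transpose = -C)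
    (hab : Function.Injective (Sum.elim a b)) {l : Fin m → ℝ} (hl0 : ∀ k, l k ≠ 0)
    (hl : ∀ j k, l j ^ 2 = l k ^ 2 → j = k) (k : Fin m) :
    ∃ c : ℝ, c ≠ 0 ∧ ∀ s : ℝ,
      hermitianDet (weightedMatching C a b (0, l + s • Pi.single k 1)) (l k) ^ 2 =
        s ^ 2 * ((2 * l k + s) ^ 2 * c) := by
  have hba : b k ≠ a k := fun h => Sum.inr_ne_inl (hab (a₁ := .inr k) (a₂ := .inl k) h)
  refine ⟨∏ v ∈ (Finset.univ.erase (a k)).erase (b k), (l k ^ 2 - ∑ j, l j ^ 2 *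
    ((if a j = v then 1 else 0) + (if b j = v then 1 else 0))), ?_, fun s => ?_⟩
  · refine Finset.prod_ne_zero_iff.mpr fun v hv => ?_
    simp only [Finset.mem_erase, Finset.mem_univ, and_true] at hv
    by_cases hav : ∃ j, a j = v
    · obtain ⟨j, rfl⟩ := hav
      rw [sum_weights_at_fst hab, sub_ne_zero]
      intro h
      exact hv.2 (by rw [hl _ _ h])
    by_cases hbv : ∃ j, b j = v
    · obtain ⟨j, rfl⟩ := hbv
      rw [sum_weights_at_snd hab, sub_ne_zero]
      intro h
      exact hv.1 (by rw [hl _ _ h])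
    push Not at hav hbv
    simp [hav, hbv, hl0]
  · rw [hermitianDet_weightedMatching_sq hC hab,
      ← Finset.mul_prod_erase _ _ (Finset.mem_univ (a k)),
      ← Finset.mul_prod_erase _ _ (Finset.mem_erase.mpr ⟨hba, Finset.mem_univ (b k)⟩),
      sum_weights_at_fst hab, sum_weights_at_snd hab]
    have hrest : ∀ v ∈ (Finset.univ.erase (a k)).erase (b k),
        l k ^ 2 - ∑ j, (l + s • Pi.single k 1 : Fin m → ℝ) j ^ 2 *
          ((if a j = v then 1 else 0) + (if b j = v then 1 else 0)) =
        l k ^ 2 - ∑ j, l j ^ 2 *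
          ((if a j = v then 1 else 0) + (if b j = v then 1 else 0)) := by
      intro v hv
      simp only [Finset.mem_erase, Finset.mem_univ, and_true] at hv
      congr 1
      refine Finset.sum_congr rfl fun j _ => ?_
      by_cases hj : j = k
      · subst hj
        simp [hv.1.symm, hv.2.symm]
      · simp [hj]
    rw [Finset.prod_congr rfl hrest]
    simp only [Pi.add_apply, Pi.smul_apply, Pi.single_eq_same, smul_eq_mul, mul_one]
    ring

theorem contDiff_hermitianDet_weightedMatching (t : ℝ) :
    ContDiff ℝ 1 fun p : ℝ × (Fin m → ℝ) => hermitianDet (weightedMatching C a b p) t := by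
  have hentry (i j : V) :
      ContDiff ℝ 1 fun p : ℝ × (Fin m → ℝ) => weightedMatching C a b p i j := by
    simp only [weightedMatching_apply]
    fun_prop
  simp only [hermitianDet, det_apply]
  refine Complex.reCLM.contDiff.comp (ContDiff.sum fun σ _ => ContDiff.const_smul _ ?_)
  refine contDiff_prod fun i _ => ?_
  simp only [Matrix.add_apply, Matrix.smul_apply, map_apply]
  exact contDiff_const.add
    (ContDiff.const_smul _ (Complex.ofRealCLM.contDiff.comp (hentry _ _)))

end WeightedMatching

/-! ### Perturbing a matching to the whole graph -/

/-- A function vanishing to first order exactly has nonzero derivative. -/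
theorem HasDerivAt.ne_zero_of_sq_eq {φ g : ℝ → ℝ} {φ' : ℝ} (hφ : HasDerivAt φ φ' 0)
    (hg : ContinuousAt g 0) (hg0 : g 0 ≠ 0) (h : ∀ s, φ s ^ 2 = s ^ 2 * g s) : φ' ≠ 0 := by
  rintro rfl
  have hφ0 : φ 0 = 0 := by simpa using h 0
  have h1 := (hasDerivAt_iff_tendsto_slope.mp hφ).pow 2
  have h2 : Filter.Tendsto g (nhdsWithin 0 {0}ᶜ) (nhds (g 0)) := hg.tendsto.mono_left inf_le_left
  refine hg0 ?_
  rw [zero_pow two_ne_zero] at h1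
  refine tendsto_nhds_unique (h2.congr' ?_) h1
  filter_upwards [self_mem_nhdsWithin] with s hs
  have hs' : s ≠ 0 := hs
  rw [slope_def_field, hφ0, sub_zero, sub_zero, div_pow, h, mul_div_cancel_left₀ _ (by positivity)]

/-- The implicit function argument. If `F (0, ·)` vanishes at `l` and its Jacobian there is
diagonal with nonzero diagonal entries, then arbitrarily close to `(0, l)` there are zeros of `F`
with nonzero first coordinate. -/
theorem exists_zero_of_diagonal_jacobian {m : ℕ} {F : ℝ × (Fin m → ℝ) → Fin m → ℝ}
    (hF : ContDiff ℝ 1 F) {l : Fin m → ℝ} (h0 : F (0, l) = 0)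
    (hoff : ∀ j k, j ≠ k → fderiv ℝ F (0, l) (0, Pi.single j 1) k = 0)
    (hdiag : ∀ k, fderiv ℝ F (0, l) (0, Pi.single k 1) k ≠ 0)
    {U : Set (ℝ × (Fin m → ℝ))} (hU : U ∈ nhds (0, l)) :
    ∃ p ∈ U, p.1 ≠ 0 ∧ F p = 0 := by
  set D := fderiv ℝ F (0, l) with hD
  have hstrict : HasStrictFDerivAt (fun p => (p.1, F p))
      ((ContinuousLinearMap.fst ℝ ℝ (Fin m → ℝ)).prod D) (0, l) :=
    hasStrictFDerivAt_fst.prodMk (hF.contDiffAt.hasStrictFDerivAt one_ne_zero)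
  have hsurj : ((ContinuousLinearMap.fst ℝ ℝ (Fin m → ℝ)).prod D).range = ⊤ := by
    rw [LinearMap.range_eq_top]
    rintro ⟨ε, y⟩
    -- The Jacobian in `x` is diagonal, so the linear system is solved coordinatewise.
    let z : Fin m → ℝ := fun k => (y k - D (ε, 0) k) / D (0, Pi.single k 1) k
    refine ⟨(ε, z), Prod.ext rfl (funext fun k => ?_)⟩
    have hz : (ε, z) = (ε, (0 : Fin m → ℝ)) + ∑ j, z j • ((0 : ℝ), (Pi.single j 1 : Fin m → ℝ)) := by
      refine Prod.ext ?_ ?_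
      · simp [Prod.fst_sum]
      · funext i
        simp [Prod.snd_sum, Finset.sum_apply, Pi.single_apply]
    change D (ε, z) k = y k
    rw [hz, map_add, map_sum, Pi.add_apply, Finset.sum_apply, Finset.sum_eq_single k]
    · rw [map_smul, Pi.smul_apply, smul_eq_mul, div_mul_cancel₀ _ (hdiag k)]
      ring
    · intro j _ hj
      rw [map_smul, Pi.smul_apply, hoff j k hj, smul_zero]
    · simp
  have hmap := hstrict.map_nhds_eq_of_surj hsurj
  simp only [h0] at hmap
  have himage : (fun p => (p.1, F p)) '' U ∈ nhds ((0 : ℝ), (0 : Fin m → ℝ)) :=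
    hmap ▸ Filter.image_mem_map hU
  have hcont : Filter.Tendsto (fun ε : ℝ => (ε, (0 : Fin m → ℝ))) (nhdsWithin 0 {0}ᶜ)
      (nhds ((0 : ℝ), (0 : Fin m → ℝ))) :=
    (Continuous.prodMk_left _).continuousAt.tendsto.mono_left inf_le_left
  obtain ⟨ε, ⟨p, hpU, hp⟩, hε⟩ :=
    ((hcont.eventually himage).and self_mem_nhdsWithin).exists
  obtain ⟨h1, h2⟩ := Prod.mk.inj hp
  exact ⟨p, hpU, h1 ▸ hε, h2⟩

/-- The eigenvalues of the matching alone survive in the whole graph: nonzero numbers `l k` with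
distinct squares, one for each edge of a matching of `G`, are values at which `det (t + i A)`
vanishes for some skew-symmetric matrix `A` with graph `G`. -/
theorem exists_mem_skewMatrices_hermitianDet_eq_zero {V : Type*} [Fintype V] [DecidableEq V]
    {G : SimpleGraph V} {m : ℕ} {a b : Fin m → V} (hG : ∀ k, G.Adj (a k) (b k))
    (hab : Function.Injective (Sum.elim a b)) {l : Fin m → ℝ} (hl0 : ∀ k, l k ≠ 0)
    (hl : ∀ j k, l j ^ 2 = l k ^ 2 → j = k) :
    ∃ A ∈ skewMatrices G, ∀ k, hermitianDet A (l k) = 0 := by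
  obtain ⟨C, hC, hCG⟩ := exists_skew_of_adj G
  let F : ℝ × (Fin m → ℝ) → Fin m → ℝ :=
    fun p k => hermitianDet (weightedMatching C a b p) (l k)
  have hF : ContDiff ℝ 1 F :=
    contDiff_pi.mpr fun k => contDiff_hermitianDet_weightedMatching (l k)
  have hline (j k : Fin m) :
      HasDerivAt (fun s : ℝ => F (0, l + s • Pi.single j 1) k)
        (fderiv ℝ F (0, l) (0, Pi.single j 1) k) 0 := by
    have h1 := (hF.differentiable one_ne_zero (0, l)).hasFDerivAt.hasLineDerivAt
      ((0 : ℝ), (Pi.single j 1 : Fin m → ℝ))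
    have h2 := hasDerivAt_pi.mp (h1 : HasDerivAt _ _ _) k
    simpa using h2
  have hU : ∀ᶠ p : ℝ × (Fin m → ℝ) in nhds (0, l), ∀ k, p.1 * C (a k) (b k) + p.2 k ≠ 0 := by
    refine Filter.eventually_all.mpr fun k => ?_
    have hc : Continuous fun p : ℝ × (Fin m → ℝ) => p.1 * C (a k) (b k) + p.2 k := by fun_prop
    exact hc.continuousAt.eventually_ne (by simpa using hl0 k)
  have hoff : ∀ j k, j ≠ k → fderiv ℝ F (0, l) (0, Pi.single j 1) k = 0 := by
    intro j k hjk
    refine (hline j k).unique ?_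
    have : (fun s : ℝ => F (0, l + s • Pi.single j 1) k) = fun _ => 0 := by
      funext s
      have h := hermitianDet_weightedMatching_eq_zero hC hab (l + s • Pi.single j 1) k
      rwa [Pi.add_apply, Pi.smul_apply, Pi.single_eq_of_ne hjk.symm, smul_zero, add_zero] at h
    rw [this]
    exact hasDerivAt_const _ _
  have hdiag : ∀ k, fderiv ℝ F (0, l) (0, Pi.single k 1) k ≠ 0 := by
    intro k
    obtain ⟨c, hc, h⟩ := exists_hermitianDet_weightedMatching_sq_eq hC hab hl0 hl k
    refine (hline k k).ne_zero_of_sq_eq (g := fun s => (2 * l k + s) ^ 2 * c) ?_ ?_ h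
    · fun_prop
    · simpa using ⟨hl0 k, hc⟩
  obtain ⟨p, hpU, hp0, hp⟩ := exists_zero_of_diagonal_jacobian hF
    (funext fun k => hermitianDet_weightedMatching_eq_zero hC hab l k) hoff hdiag hU
  exact ⟨_, weightedMatching_mem_skewMatrices hC hCG hG hab hp0 hpU, fun k => congrFun hp k⟩

theorem mainTheorem2 {V : Type*} [Fintype V] [DecidableEq V] (G : SimpleGraph V)
    (hG : G.Connected) (n : ℕ) (hn : Fintype.card V = n) :
    (matchingNumber G = n / 2 →
      ∀ l : Fin n → ℝ, Function.Injective l → (∀ j : Fin n, l j = -l j.rev) →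
        ∃ A ∈ skewMatrices G,
          complexEigenvalues A =
            (Finset.univ : Finset (Fin n)).val.map fun j => Complex.I * (l j : ℂ)) ∧
    ((∃ A ∈ skewMatrices G, (complexEigenvalues A).Nodup) → matchingNumber G = n / 2) := by
  refine ⟨fun hm l hl hsymm => ?_, ?_⟩
  · obtain ⟨M, hM, hMc⟩ := exists_isMatching_ncard_eq_matchingNumber G
    obtain ⟨a, b, hadj, hab⟩ := hM.exists_endpoints (hMc.trans hm)
    -- The first half of the list; the second half consists of the negatives.
    let f : Fin (n / 2) → Fin n := Fin.castLE (Nat.div_le_self n 2)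
    have hrev (j k : Fin (n / 2)) : f j ≠ (f k).rev := by
      intro h
      have := congrArg Fin.val h
      simp only [f, Fin.val_castLE, Fin.val_rev] at this
      omega
    have hl0 : ∀ k, l (f k) ≠ 0 := by
      intro k h
      have h' := hsymm (f k)
      exact hrev k k (hl (by linarith))
    have hsq : ∀ j k, l (f j) ^ 2 = l (f k) ^ 2 → j = k := by
      intro j k h
      rcases sq_eq_sq_iff_eq_or_eq_neg.mp h with h | h
      · exact Fin.castLE_injective _ (hl h)
      · have h' := hsymm (f k)
        exact absurd (hl (by linarith)) (hrev j k)
    obtain ⟨A, hA, hdet⟩ :=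
      exists_mem_skewMatrices_hermitianDet_eq_zero hadj hab (l := fun k => l (f k)) hl0 hsq
    refine ⟨A, hA, complexEigenvalues_eq_of_hermitianDet hn hA.1 hl fun j => ?_⟩
    rcases lt_trichotomy (j : ℕ) (j.rev : ℕ) with h | h | h
    · have hj : (j : ℕ) < n / 2 := by
        rw [Fin.val_rev] at h
        omega
      exact hdet ⟨j, hj⟩
    · have h0 : l j = 0 := by
        have := hsymm j
        rw [← Fin.ext h] at this
        linarith
      rw [h0]
      refine hermitianDet_zero_of_odd hA.1 ?_
      rw [Fin.val_rev] at h
      rw [hn, Nat.odd_iff]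
      omega
    · have hj : (j.rev : ℕ) < n / 2 := by
        rw [Fin.val_rev] at h ⊢
        omega
      rw [hsymm j]
      exact hermitianDet_neg hA.1 (hdet ⟨j.rev, hj⟩)
  · rintro ⟨A, hA, h⟩
    rw [← hn]
    exact matchingNumber_eq_half_of_nodup hA h
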